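/- Model. A problem instance with $N$ items, dimension $d$, capacity $K\ge 1$ and horizon $T$ consists of feature vectors $v_{ti}\in\mathbb R^d$ and revenues $r_{ti}\in[0,1]$ ($1\le t\le T$, $1\le i\le N$) and a coefficient $\theta_0\in\mathbb R^d$. In period $t$ the seller observes $(v_{ti},r_{ti})_{i\le N}$ and offers an assortment $S_t\subseteq\{1,\dots,N\}$ with $|S_t|\le K$. The customer then buys item $j\in S_t$ with probability $\exp(v_{tj}^\top\theta_0)/(1+\sum_{k\in S_t}\exp(v_{tk}^\top\theta_0))$ and buys nothing with probability $1/(1+\sum_{k\in S_t}\exp(v_{tk}^\top\theta_0))$. A policy $\pi$ chooses $S_t$, possibly at random, on the basis of the features and revenues of periods $1,\dots,t$ and of the assortments and purchases of periods $1,\dots,t-1$; it does not know $\theta_0$. With $R_t(S)=\sum_{j\in S}r_{tj}\exp(v_{tj}^\top\theta_0)/(1+\sum_{j\in S}\exp(v_{tj}^\top\theta_0))$, its regret on the instance is $\mathbb E^\pi\sum_{t=1}^T\bigl(\max_{|S|\le K}R_t(S)-R_t(S_t)\bigr)$. Theorem. There are universal constants $C_0,c_1,c_2>0$ such that the following holds.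 Let $d$ be divisible by $4$. Then there is $T_0$, depending only on $d$, such that for every $K\ge1$ there is an $N$ with $c_1K2^d\le N\le c_2K2^d$ such that for every $T\ge T_0$ and every policy $\pi$ (which may depend on $d,N,K,T$) there is a problem instance with $N$ items, $\|v_{ti}\|_2\le1$ for all $t,i$ and $\|\theta_0\|_2\le1$, on which the regret of $\pi$ is at least $C_0\,d\sqrt T/K$. -/

import Mathlib

open scoped BigOperators

noncomputable section

/-- What the seller observes at the start of one period: a feature vector in `ℝᵈ` and a revenue
in `[0, 1]` for each of the `N` items. -/
structure MNLContext (d N : ℕ) where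
  feature : Fin N → EuclideanSpace ℝ (Fin d)
  revenue : Fin N → ℝ
  revenue_mem : ∀ i, revenue i ∈ Set.Icc (0 : ℝ) 1

/-- An assortment: a set of at most `K` of the `N` items (possibly empty). -/
abbrev Assortment (N K : ℕ) : Type := {S : Finset (Fin N) // S.card ≤ K}

/-- The record of one period: the assortment that was offered and the purchasing action
(`none` is the no-purchase alternative, `some j` the purchase of item `j`). -/
abbrev PeriodRecord (N K : ℕ) : Type := Assortment N K × Option (Fin N)

/-- A problem instance with horizon `T`: the (arbitrary, possibly time-varying) contexts of the
periods and the time-invariant coefficient `θ₀`, which is hidden from the seller. -/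
structure MNLInstance (d N T : ℕ) where
  context : Fin T → MNLContext d N
  coeff : EuclideanSpace ℝ (Fin d)

/-- A (randomized, history-dependent, non-anticipating) policy. In period `t` it sees the contexts
of the periods `0, …, t` and the assortments and purchases of the periods `0, …, t - 1`, and
draws the assortment to offer from a distribution that depends on them. -/
structure AssortmentPolicy (d N K T : ℕ) where
  choose : (t : Fin T) → (Fin (t.val + 1) → MNLContext d N) →
    (Fin t.val → PeriodRecord N K) → PMF (Assortment N K)

/-- The attraction weight `exp(vᵢᵀ θ)` of item `i`. -/
def MNLContext.weight {d N : ℕ} (c : MNLContext d N) (θ : EuclideanSpace ℝ (Fin d))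
    (i : Fin N) : ℝ :=
  Real.exp (inner ℝ (c.feature i) θ)

/-- The multinomial logit probability of a purchasing action when `S` is offered. -/
def MNLContext.choiceProb {d N : ℕ} (c : MNLContext d N) (θ : EuclideanSpace ℝ (Fin d))
    (S : Finset (Fin N)) : Option (Fin N) → ℝ
  | none => 1 / (1 + ∑ k ∈ S, c.weight θ k)
  | some j => if j ∈ S then c.weight θ j / (1 + ∑ k ∈ S, c.weight θ k) else 0

/-- The expected revenue `R(S)` of the set `S` of items. -/
def MNLContext.expectedRevenue {d N : ℕ} (c : MNLContext d N) (θ : EuclideanSpace ℝ (Fin d))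
    (S : Finset (Fin N)) : ℝ :=
  (∑ j ∈ S, c.revenue j * c.weight θ j) / (1 + ∑ j ∈ S, c.weight θ j)

/-- The largest expected revenue of an assortment of at most `K` items
(a maximum over a finite nonempty set). -/
def MNLContext.optimalRevenue {d N : ℕ} (c : MNLContext d N) (θ : EuclideanSpace ℝ (Fin d))
    (K : ℕ) : ℝ :=
  ⨆ S : Assortment N K, c.expectedRevenue θ S.1

/-- The probability of the trajectory `h` (assortments and purchases of all `T` periods) when the
policy `π` is run on the instance `I`. -/
def AssortmentPolicy.trajectoryProb {d N K T : ℕ} (π : AssortmentPolicy d N K T)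
    (I : MNLInstance d N T) (h : Fin T → PeriodRecord N K) : ℝ :=
  ∏ t : Fin T,
    (π.choose t (fun s => I.context (Fin.castLE t.isLt s))
        (fun s => h (Fin.castLE t.isLt.le s)) (h t).1).toReal *
      (I.context t).choiceProb I.coeff (h t).1.1 (h t).2

/-- The regret of the policy `π` on the instance `I`:
the expectation of `∑ₜ (Rₜ(Sₜ*) - Rₜ(Sₜ))` under the law of the trajectory. -/
def AssortmentPolicy.regret {d N K T : ℕ} (π : AssortmentPolicy d N K T)
    (I : MNLInstance d N T) : ℝ :=
  ∑ h : Fin T → PeriodRecord N K, π.trajectoryProb I h *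
    ∑ t : Fin T, ((I.context t).optimalRevenue I.coeff K -
      (I.context t).expectedRevenue I.coeff (h t).1.1)

end

/-! Every period shows the same context: all revenues are one, and each vertex `v` of `{±1}^d`,
scaled to norm one, is the feature of `K` items. With `r = 1/√T` and coefficient `√d * r * s` for a
hidden sign vector `s`, such an item has utility `r⟨v, s⟩`, so `K` copies of `s` are the benchmark.
By `mnl_revenue_gap` an assortment loses at least `r/(48K²)` times a sum over coordinates `i` of `K
- s_i ∑ v_i`, a loss that involves only the bit `s_i`.

Flipping one bit moves every utility by at most `2r`. One purchase then has affinity at least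
`exp(-r²/2)` whatever is offered (`exp_le_sum_sqrt_choiceProb`), and `T` periods at least
`exp(-1/2)` (`exp_le_sum_sqrt_trajectoryProb`): no policy can identify the bit. Hence
`assouad_hypercube` yields an `s` whose coordinate losses total at least order `d * K * T`, and
multiplying by `r/K²` gives `d√T/K`. -/

/-! ### Products of history-dependent kernels -/

/-- The mass of a product of `T + 1` kernels, with the last step summed out. -/
lemma sum_prod_kernel_succ {Ω : Type*} [Fintype Ω] (T : ℕ)
    (g : (t : Fin (T + 1)) → (Fin t.val → Ω) → Ω → ℝ) :
    ∑ h : Fin (T + 1) → Ω, ∏ t : Fin (T + 1),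
        g t (fun s => h (Fin.castLE t.isLt.le s)) (h t) =
      ∑ h : Fin T → Ω, (∏ t : Fin T,
        g t.castSucc (fun s => h (Fin.castLE t.isLt.le s)) (h t)) *
          ∑ ω, g (Fin.last T) h ω := by
  rw [← (Fin.snocEquiv (fun _ : Fin (T + 1) => Ω)).sum_comp, Fintype.sum_prod_type_right]
  refine Finset.sum_congr rfl fun h _ => ?_
  rw [Finset.mul_sum]
  refine Finset.sum_congr rfl fun ω _ => ?_
  rw [Fin.prod_univ_castSucc]
  congr 1
  · refine Finset.prod_congr rfl fun t _ => ?_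
    congr 1
    · funext s
      exact Fin.snoc_castSucc (α := fun _ => Ω) ω h (Fin.castLE t.isLt.le s)
    · exact Fin.snoc_castSucc (α := fun _ => Ω) ω h t
  · congr 1
    · funext s
      exact Fin.snoc_castSucc (α := fun _ => Ω) ω h s
    · exact Fin.snoc_last (α := fun _ => Ω) ω h

/-- The total mass of a product of one-step kernels, each of mass at least `ρ`. -/
lemma pow_le_sum_prod_kernel {Ω : Type*} [Fintype Ω] {ρ : ℝ} (hρ : 0 ≤ ρ) (T : ℕ)
    (g : (t : Fin T) → (Fin t.val → Ω) → Ω → ℝ) (hg : ∀ t h ω, 0 ≤ g t h ω)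
    (hs : ∀ t h, ρ ≤ ∑ ω, g t h ω) :
    ρ ^ T ≤ ∑ h : Fin T → Ω, ∏ t : Fin T, g t (fun s => h (Fin.castLE t.isLt.le s)) (h t) := by
  induction T with
  | zero => simp
  | succ T ih =>
    have key := ih (fun t => g t.castSucc) (fun t => hg t.castSucc) (fun t => hs t.castSucc)
    rw [sum_prod_kernel_succ, pow_succ]
    refine (mul_le_mul_of_nonneg_right key hρ).trans ?_
    rw [Finset.sum_mul]
    exact Finset.sum_le_sum fun h _ =>
      mul_le_mul_of_nonneg_left (hs _ _) (Finset.prod_nonneg fun t _ => hg _ _ _)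

/-- The total mass of a product of probability kernels is one. -/
lemma sum_prod_kernel_eq_one {Ω : Type*} [Fintype Ω] (T : ℕ)
    (g : (t : Fin T) → (Fin t.val → Ω) → Ω → ℝ) (hs : ∀ t h, ∑ ω, g t h ω = 1) :
    ∑ h : Fin T → Ω, ∏ t : Fin T, g t (fun s => h (Fin.castLE t.isLt.le s)) (h t) = 1 := by
  induction T with
  | zero => simp
  | succ T ih =>
    rw [sum_prod_kernel_succ, ← ih (fun t => g t.castSucc) (fun t => hs t.castSucc)]
    exact Finset.sum_congr rfl fun h _ => by
      rw [hs (Fin.last T) h, mul_one]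
      rfl

lemma PMF.sum_toReal_eq_one {α : Type*} [Fintype α] (p : PMF α) : ∑ a, (p a).toReal = 1 := by
  rw [← ENNReal.toReal_sum fun a _ => p.apply_ne_top a, ← tsum_fintype (L := .unconditional α),
    p.tsum_coe, ENNReal.toReal_one]

/-! ### Le Cam and Assouad -/

/-- Le Cam's inequality between the affinity and the overlap of two distributions. -/
lemma sq_sum_sqrt_mul_le_sum_min {ι : Type*} [Fintype ι] (p q : ι → ℝ) (hp : ∀ i, 0 ≤ p i)
    (hq : ∀ i, 0 ≤ q i) (hp1 : ∑ i, p i = 1) (hq1 : ∑ i, q i = 1) :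
    (∑ i, √(p i * q i)) ^ 2 ≤ 2 * ∑ i, min (p i) (q i) := by
  have hmin : ∀ i, 0 ≤ min (p i) (q i) := fun i => le_min (hp i) (hq i)
  have hmax : ∀ i, 0 ≤ max (p i) (q i) := fun i => le_max_of_le_left (hp i)
  -- Since `pq = min · max`, Cauchy–Schwarz bounds the squared affinity by `(∑ min)(∑ max)`.
  have h1 : ∑ i, √(p i * q i) = ∑ i, √(min (p i) (q i)) * √(max (p i) (q i)) :=
    Finset.sum_congr rfl fun i _ => by rw [← Real.sqrt_mul (hmin i), min_mul_max]
  have h2 : ∑ i, max (p i) (q i) ≤ 2 := by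
    calc ∑ i, max (p i) (q i) ≤ ∑ i, (p i + q i) :=
          Finset.sum_le_sum fun i _ => max_le_add_of_nonneg (hp i) (hq i)
      _ = 2 := by rw [Finset.sum_add_distrib, hp1, hq1]; norm_num
  rw [h1]
  refine (Finset.sum_mul_sq_le_sq_mul_sq _ _ _).trans ?_
  simp only [Real.sq_sqrt (hmin _), Real.sq_sqrt (hmax _)]
  rw [mul_comm]
  exact mul_le_mul_of_nonneg_right h2 (Finset.sum_nonneg fun i _ => hmin i)

/-- Assouad's lemma on the hypercube, with the separation measured by losses `D i h b` that satisfy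
`D i h true + D i h false = L`. -/
lemma assouad_hypercube {ι : Type*} [Fintype ι] {d : ℕ} (P : (Fin d → Bool) → ι → ℝ)
    (hP : ∀ s h, 0 ≤ P s h) (hP1 : ∀ s, ∑ h, P s h = 1) {ρ : ℝ} (hρ : 0 ≤ ρ)
    (haff : ∀ s i, ρ ≤ ∑ h, √(P s h * P (Function.update s i (!s i)) h))
    (D : Fin d → ι → Bool → ℝ) (hD : ∀ i h b, 0 ≤ D i h b) {L : ℝ}
    (hDL : ∀ i h b, D i h b + D i h (!b) = L) :
    ∃ s, (d : ℝ) * (L * ρ ^ 2 / 4) ≤ ∑ i, ∑ h, P s h * D i h (s i) := by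
  have hpair : ∀ s i, L * ρ ^ 2 / 2 ≤ (∑ h, P s h * D i h (s i)) +
      ∑ h, P (Function.update s i (!s i)) h * D i h (Function.update s i (!s i) i) := by
    intro s i
    set s' := Function.update s i (!s i) with hs'
    have hsi : s' i = !s i := by simp [hs']
    rw [hsi, ← Finset.sum_add_distrib]
    have h1 : L * ∑ h, min (P s h) (P s' h) ≤
        ∑ h, (P s h * D i h (s i) + P s' h * D i h (!s i)) := by
      rw [Finset.mul_sum]
      refine Finset.sum_le_sum fun h _ => ?_
      rw [← hDL i h (s i), add_mul, mul_comm, mul_comm (D i h (!s i))]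
      exact add_le_add (mul_le_mul_of_nonneg_right (min_le_left _ _) (hD _ _ _))
        (mul_le_mul_of_nonneg_right (min_le_right _ _) (hD _ _ _))
    have h2 := sq_sum_sqrt_mul_le_sum_min (P s) (P s') (hP s) (hP s') (hP1 s) (hP1 s')
    have h3 : ρ ^ 2 ≤ (∑ h, √(P s h * P s' h)) ^ 2 := pow_le_pow_left₀ hρ (haff s i) 2
    -- The sign of `L` is read off from a value of `D`; an empty `ι` contradicts total mass one.
    rcases isEmpty_or_nonempty ι with hι | ⟨⟨h⟩⟩
    · simpa using hP1 s
    have hL : 0 ≤ L := by rw [← hDL i h true]; exact add_nonneg (hD _ _ _) (hD _ _ _)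
    nlinarith [mul_le_mul_of_nonneg_left (h3.trans h2) hL]
  have hcoord : ∀ i, ∑ _s : Fin d → Bool, L * ρ ^ 2 / 4 ≤
      ∑ s : Fin d → Bool, ∑ h, P s h * D i h (s i) := by
    intro i
    -- Flipping bit `i` permutes the cube, so both halves of `hpair` have the same sum over `s`.
    have hinv : Function.Involutive fun s : Fin d → Bool => Function.update s i (!s i) := by
      intro s; simp
    have h1 := (Equiv.sum_comp hinv.toPerm
      (fun s : Fin d → Bool => ∑ h, P s h * D i h (s i)))
    have h2 := Finset.sum_le_sum fun (s : Fin d → Bool) (_ : s ∈ Finset.univ) => hpair s i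
    rw [Finset.sum_add_distrib] at h2
    simp only [Function.Involutive.coe_toPerm] at h1
    rw [h1] at h2
    have h3 : ∑ _s : Fin d → Bool, L * ρ ^ 2 / 2 = 2 * ∑ _s : Fin d → Bool, L * ρ ^ 2 / 4 := by
      rw [Finset.mul_sum]; exact Finset.sum_congr rfl fun _ _ => by ring
    linarith
  obtain ⟨s, -, hs⟩ := Finset.exists_le_of_sum_le (s := (Finset.univ : Finset (Fin d → Bool)))
    (f := fun _ => (d : ℝ) * (L * ρ ^ 2 / 4)) (g := fun s => ∑ i, ∑ h, P s h * D i h (s i))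
    Finset.univ_nonempty (by
      rw [Finset.sum_comm (s := (Finset.univ : Finset (Fin d → Bool)))]
      refine le_trans (le_of_eq ?_) (Finset.sum_le_sum fun i _ => hcoord i)
      simp only [Finset.sum_const, Finset.card_univ, Fintype.card_fin, nsmul_eq_mul]
      ring)
  exact ⟨s, hs⟩

/-! ### Affinity of logit choices -/

namespace MNLContext

variable {d N : ℕ} (c : MNLContext d N) (θ θ' : EuclideanSpace ℝ (Fin d)) (S : Finset (Fin N))

lemma weight_pos (i : Fin N) : 0 < c.weight θ i := Real.exp_pos _

lemma one_add_sum_weight_pos : 0 < 1 + ∑ k ∈ S, c.weight θ k :=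
  add_pos_of_pos_of_nonneg one_pos (Finset.sum_nonneg fun i _ => (c.weight_pos θ i).le)

lemma choiceProb_nonneg (a : Option (Fin N)) : 0 ≤ c.choiceProb θ S a := by
  have h := c.one_add_sum_weight_pos θ S
  rcases a with _ | j
  · exact div_nonneg zero_le_one h.le
  · rw [choiceProb]
    split_ifs
    · exact div_nonneg (c.weight_pos θ j).le h.le
    · exact le_rfl

lemma sum_choiceProb : ∑ a, c.choiceProb θ S a = 1 := by
  have h := (c.one_add_sum_weight_pos θ S).ne'
  rw [Fintype.sum_option]
  simp only [choiceProb]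
  rw [Finset.sum_ite_mem, Finset.univ_inter, ← Finset.sum_div, ← add_div, div_self h]

/-- The affinity of two choice distributions whose utilities differ by at most `2 * u`. -/
lemma exp_le_sum_sqrt_choiceProb {u : ℝ}
    (hu : ∀ i, |inner ℝ (c.feature i) θ - inner ℝ (c.feature i) θ'| ≤ 2 * u) (hu0 : 0 ≤ u) :
    Real.exp (-(u ^ 2 / 2)) ≤ ∑ a, √(c.choiceProb θ S a * c.choiceProb θ' S a) := by
  have hA := c.one_add_sum_weight_pos θ S
  have hA' := c.one_add_sum_weight_pos θ' S
  set A := 1 + ∑ k ∈ S, c.weight θ k with hAdef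
  set A' := 1 + ∑ k ∈ S, c.weight θ' k with hAdef'
  -- The geometric mean of the two weights, which is the numerator of the affinity.
  set y : Fin N → ℝ :=
    fun k => Real.exp ((inner ℝ (c.feature k) θ + inner ℝ (c.feature k) θ') / 2) with hy
  have hyy : ∀ k, c.weight θ k * c.weight θ' k = y k * y k := by
    intro k
    simp only [weight, hy, ← Real.exp_add]
    congr 1; ring
  have hsum : ∑ a, √(c.choiceProb θ S a * c.choiceProb θ' S a) =
      (1 + ∑ k ∈ S, y k) / √(A * A') := by
    have e : ∀ j, √(c.choiceProb θ S (some j) * c.choiceProb θ' S (some j)) =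
        if j ∈ S then y j / √(A * A') else 0 := by
      intro j
      simp only [choiceProb, ← hAdef, ← hAdef']
      split_ifs
      · rw [div_mul_div_comm, hyy, Real.sqrt_div (mul_self_nonneg _),
          Real.sqrt_mul_self (Real.exp_pos _).le]
      · simp
    rw [Fintype.sum_option, Finset.sum_congr rfl fun j _ => e j, Finset.sum_ite_mem,
      Finset.univ_inter, ← Finset.sum_div, add_div]
    congr 1
    simp only [choiceProb, ← hAdef, ← hAdef']
    rw [div_mul_div_comm, one_mul, Real.sqrt_div zero_le_one, Real.sqrt_one]
  have hcosh : ∀ k, c.weight θ k + c.weight θ' k ≤ 2 * Real.cosh u * y k := by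
    intro k
    have h1 : c.weight θ k + c.weight θ' k = 2 *
        Real.cosh ((inner ℝ (c.feature k) θ - inner ℝ (c.feature k) θ') / 2) * y k := by
      rw [Real.cosh_eq, mul_div_cancel₀ _ (two_ne_zero' ℝ), add_mul]
      simp only [weight, hy, ← Real.exp_add]
      congr 2 <;> ring
    rw [h1]
    refine mul_le_mul_of_nonneg_right ?_ (Real.exp_pos _).le
    refine mul_le_mul_of_nonneg_left (Real.cosh_le_cosh.2 ?_) zero_le_two
    rw [abs_div, abs_of_nonneg hu0, abs_two]
    linarith [hu k]
  have hAA : A + A' ≤ 2 * Real.cosh u * (1 + ∑ k ∈ S, y k) := by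
    have h1 := Finset.sum_le_sum fun k (_ : k ∈ S) => hcosh k
    rw [Finset.sum_add_distrib, ← Finset.mul_sum] at h1
    -- The no-purchase option contributes `2 ≤ 2 cosh u`.
    have h2 := Real.one_le_cosh u
    rw [hAdef, hAdef', mul_add]
    linarith
  have hgm : 2 * √(A * A') ≤ A + A' := by
    rw [Real.sqrt_mul hA.le]
    nlinarith [sq_nonneg (√A - √A'), Real.sq_sqrt hA.le, Real.sq_sqrt hA'.le]
  have hY : 0 < 1 + ∑ k ∈ S, y k :=
    add_pos_of_pos_of_nonneg one_pos (Finset.sum_nonneg fun i _ => (Real.exp_pos _).le)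
  rw [hsum, le_div_iff₀ (Real.sqrt_pos.2 (mul_pos hA hA')), Real.exp_neg,
    inv_mul_le_iff₀ (Real.exp_pos _)]
  have h3 := mul_le_mul_of_nonneg_right (Real.cosh_le_exp_half_sq u) hY.le
  linarith

end MNLContext

/-! ### Affinity of trajectory laws -/

namespace AssortmentPolicy

variable {d N K T : ℕ} (π : AssortmentPolicy d N K T)

lemma trajectoryProb_nonneg (I : MNLInstance d N T) (h : Fin T → PeriodRecord N K) :
    0 ≤ π.trajectoryProb I h :=
  Finset.prod_nonneg fun _ _ =>
    mul_nonneg ENNReal.toReal_nonneg (MNLContext.choiceProb_nonneg _ _ _ _)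

lemma sum_trajectoryProb (I : MNLInstance d N T) : ∑ h, π.trajectoryProb I h = 1 := by
  refine sum_prod_kernel_eq_one T (fun t g (ω : PeriodRecord N K) =>
    (π.choose t (fun s => I.context (Fin.castLE t.isLt s)) g ω.1).toReal *
      (I.context t).choiceProb I.coeff ω.1.1 ω.2) fun t g => ?_
  rw [Fintype.sum_prod_type]
  simp only [← Finset.mul_sum, MNLContext.sum_choiceProb, mul_one]
  exact PMF.sum_toReal_eq_one _

/-- The affinity of the trajectory laws of two instances that differ only in the coefficient. -/
lemma exp_le_sum_sqrt_trajectoryProb (x : Fin T → MNLContext d N)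
    (θ θ' : EuclideanSpace ℝ (Fin d)) {u : ℝ} (hu0 : 0 ≤ u)
    (hu : ∀ t i, |inner ℝ ((x t).feature i) θ - inner ℝ ((x t).feature i) θ'| ≤ 2 * u) :
    Real.exp (-(u ^ 2 / 2)) ^ T ≤
      ∑ h, √(π.trajectoryProb ⟨x, θ⟩ h * π.trajectoryProb ⟨x, θ'⟩ h) := by
  -- Both laws share the policy factor, so it leaves the square root intact and averages the
  -- one-period affinities.
  have key := pow_le_sum_prod_kernel (Real.exp_pos (-(u ^ 2 / 2))).le T
    (fun t g (ω : PeriodRecord N K) =>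
      (π.choose t (fun s => x (Fin.castLE t.isLt s)) g ω.1).toReal *
        √((x t).choiceProb θ ω.1.1 ω.2 * (x t).choiceProb θ' ω.1.1 ω.2))
    (fun t g ω => mul_nonneg ENNReal.toReal_nonneg (Real.sqrt_nonneg _)) (fun t g => by
      rw [Fintype.sum_prod_type]
      simp only [← Finset.mul_sum]
      rw [← one_mul (Real.exp _), ← PMF.sum_toReal_eq_one
        (π.choose t (fun s => x (Fin.castLE t.isLt s)) g), Finset.sum_mul]
      exact Finset.sum_le_sum fun S _ => mul_le_mul_of_nonneg_left
        ((x t).exp_le_sum_sqrt_choiceProb θ θ' S.1 (hu t) hu0) ENNReal.toReal_nonneg)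
  refine key.trans (Finset.sum_le_sum fun h _ => le_of_eq ?_)
  simp only [trajectoryProb]
  refine ((Real.sqrt_eq_iff_mul_self_eq (by
    rw [← Finset.prod_mul_distrib]
    exact Finset.prod_nonneg fun t _ => mul_nonneg
      (mul_nonneg ENNReal.toReal_nonneg (MNLContext.choiceProb_nonneg _ _ _ _))
      (mul_nonneg ENNReal.toReal_nonneg (MNLContext.choiceProb_nonneg _ _ _ _)))
    (Finset.prod_nonneg fun t _ =>
      mul_nonneg ENNReal.toReal_nonneg (Real.sqrt_nonneg _))).2 ?_).symm
  rw [← Finset.prod_mul_distrib, ← Finset.prod_mul_distrib]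
  refine Finset.prod_congr rfl fun t _ => ?_
  rw [mul_mul_mul_comm _ (√_), Real.mul_self_sqrt (mul_nonneg
    (MNLContext.choiceProb_nonneg _ _ _ _) (MNLContext.choiceProb_nonneg _ _ _ _)),
    mul_mul_mul_comm]

end AssortmentPolicy

/-! ### Revenue gap -/

/-- The revenue lost against `K` items of utility `a` by offering at most `K` items of utilities
`x j ∈ [-a, a]`, all revenues being one. -/
lemma mnl_revenue_gap {ι : Type*} (S : Finset ι) (x : ι → ℝ) {a : ℝ} {K : ℕ} (hK : 1 ≤ K)
    (ha0 : 0 ≤ a) (ha1 : a ≤ 1) (hx : ∀ j, |x j| ≤ a) (hS : S.card ≤ K) :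
    (K * a - ∑ j ∈ S, x j) / (48 * (K : ℝ) ^ 2) ≤
      K * Real.exp a / (1 + K * Real.exp a) -
        (∑ j ∈ S, Real.exp (x j)) / (1 + ∑ j ∈ S, Real.exp (x j)) := by
  have hK' : (1 : ℝ) ≤ K := by exact_mod_cast hK
  have hS' : (S.card : ℝ) ≤ K := by exact_mod_cast hS
  have hea : Real.exp a ≤ 3 :=
    (Real.exp_le_exp.2 ha1).trans (Real.exp_one_lt_d9.le.trans (by norm_num))
  have hea1 : 1 ≤ Real.exp a := Real.one_le_exp ha0
  have hterm : ∀ j, (a - x j) / 3 ≤ Real.exp a - Real.exp (x j) := by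
    intro j
    have h1 := (abs_le.1 (hx j)).1
    have h2 := (abs_le.1 (hx j)).2
    have h3 : 1 / 3 ≤ Real.exp (x j) := by
      have : Real.exp (-1) ≤ Real.exp (x j) := Real.exp_le_exp.2 (by linarith)
      refine le_trans ?_ this
      rw [Real.exp_neg, one_div]
      exact inv_anti₀ (Real.exp_pos _) (Real.exp_one_lt_d9.le.trans (by norm_num))
    have h4 : Real.exp a = Real.exp (x j) * Real.exp (a - x j) := by
      rw [← Real.exp_add]; congr 1; ring
    have h5 := Real.add_one_le_exp (a - x j)
    rw [h4]
    nlinarith [mul_le_mul_of_nonneg_left h5 (Real.exp_pos (x j)).le,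
      mul_le_mul_of_nonneg_right h3 (sub_nonneg.2 h2)]
  set W := ∑ j ∈ S, Real.exp (x j) with hW
  have hW0 : 0 ≤ W := Finset.sum_nonneg fun _ _ => (Real.exp_pos _).le
  have hsum := Finset.sum_le_sum fun j (_ : j ∈ S) => hterm j
  rw [← Finset.sum_div, Finset.sum_sub_distrib, Finset.sum_sub_distrib, Finset.sum_const,
    Finset.sum_const, nsmul_eq_mul, nsmul_eq_mul, ← hW] at hsum
  have hxS : ∑ j ∈ S, x j ≤ K * a := by
    refine (Finset.sum_le_sum fun j _ => (abs_le.1 (hx j)).2).trans ?_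
    rw [Finset.sum_const, nsmul_eq_mul]
    exact mul_le_mul_of_nonneg_right hS' ha0
  -- Each of the `K - S.card` missing items adds slack `exp a - a / 3 ≥ 0`.
  have hdiff : (K * a - ∑ j ∈ S, x j) / 3 ≤ K * Real.exp a - W := by
    nlinarith [mul_nonneg (sub_nonneg.2 hS') (by linarith : 0 ≤ Real.exp a - a / 3)]
  set V := K * Real.exp a with hV
  have hV3 : 1 + V ≤ 4 * K := by nlinarith
  have hWV : W ≤ V := by linarith
  have hgap : V / (1 + V) - W / (1 + W) = (V - W) / ((1 + V) * (1 + W)) := by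
    rw [div_sub_div _ _ (by positivity) (by positivity)]
    congr 1; ring
  rw [hgap]
  have hden : (1 + V) * (1 + W) ≤ 16 * (K : ℝ) ^ 2 := by
    calc (1 + V) * (1 + W) ≤ (4 * K) * (4 * K) :=
          mul_le_mul hV3 (by linarith) (by linarith) (by linarith)
      _ = 16 * (K : ℝ) ^ 2 := by ring
  calc (K * a - ∑ j ∈ S, x j) / (48 * (K : ℝ) ^ 2)
      = ((K * a - ∑ j ∈ S, x j) / 3) / (16 * (K : ℝ) ^ 2) := by rw [div_div]; congr 1; ring
    _ ≤ (V - W) / (16 * (K : ℝ) ^ 2) := by gcongr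
    _ ≤ (V - W) / ((1 + V) * (1 + W)) :=
        div_le_div_of_nonneg_left (by linarith) (by positivity) hden

/-! ### The hypercube instance -/

/-- The real sign `±1` of a Boolean. -/
noncomputable def boolSign (b : Bool) : ℝ := if b then 1 else -1

lemma boolSign_mul_self (b : Bool) : boolSign b * boolSign b = 1 := by
  cases b <;> simp [boolSign]

lemma abs_boolSign (b : Bool) : |boolSign b| = 1 := by cases b <;> simp [boolSign]

lemma boolSign_not (b : Bool) : boolSign (!b) = -boolSign b := by cases b <;> simp [boolSign]

/-- The sign vector of `s` scaled by `r`. -/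
noncomputable def signVector {d : ℕ} (r : ℝ) (s : Fin d → Bool) : EuclideanSpace ℝ (Fin d) :=
  WithLp.toLp 2 fun i => r * boolSign (s i)

lemma norm_signVector {d : ℕ} {r : ℝ} (hr : 0 ≤ r) (s : Fin d → Bool) :
    ‖signVector r s‖ = r * √d := by
  rw [EuclideanSpace.norm_eq]
  simp only [signVector, Real.norm_eq_abs, sq_abs, mul_pow]
  simp only [sq (boolSign _), boolSign_mul_self, mul_one, Finset.sum_const, Finset.card_univ,
    Fintype.card_fin, nsmul_eq_mul]
  rw [mul_comm, Real.sqrt_mul (sq_nonneg r), Real.sqrt_sq hr]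

lemma inner_signVector {d : ℕ} (r r' : ℝ) (s s' : Fin d → Bool) :
    inner ℝ (signVector r s) (signVector r' s') =
      r * r' * ∑ i, boolSign (s i) * boolSign (s' i) := by
  rw [PiLp.inner_apply, Finset.mul_sum]
  refine Finset.sum_congr rfl fun i _ => ?_
  simp only [signVector, RCLike.inner_apply, conj_trivial]
  ring

/-- The context that offers, for every vertex of the hypercube, `K` items whose feature is that
vertex (scaled to norm one); all revenues are one. -/
noncomputable def hypercubeContext {d N K : ℕ} (e : Fin N ≃ Fin K × (Fin d → Bool)) :
    MNLContext d N where
  feature j := signVector (√d)⁻¹ (e j).2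
  revenue _ := 1
  revenue_mem _ := ⟨zero_le_one, le_rfl⟩

section Hypercube

variable {d N K T : ℕ} (e : Fin N ≃ Fin K × (Fin d → Bool)) (s : Fin d → Bool)

lemma norm_hypercubeContext_feature_le (j : Fin N) :
    ‖(hypercubeContext e).feature j‖ ≤ 1 := by
  simp only [hypercubeContext]
  rw [norm_signVector (inv_nonneg.2 (Real.sqrt_nonneg _))]
  exact inv_mul_le_one

lemma inner_hypercubeContext_feature (r : ℝ) (j : Fin N) :
    inner ℝ ((hypercubeContext e).feature j) (signVector (√d * r) s) =
      r * ∑ i, boolSign ((e j).2 i) * boolSign (s i) := by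
  simp only [hypercubeContext, inner_signVector]
  -- For `d = 0` the scalings do not cancel, but the sum is empty.
  rcases Nat.eq_zero_or_pos d with rfl | hd
  · simp
  · have : √(d : ℝ) ≠ 0 := (Real.sqrt_pos.2 (by exact_mod_cast hd)).ne'
    rw [inv_mul_cancel_left₀ this]

lemma abs_inner_hypercubeContext_feature_le {r : ℝ} (hr : 0 ≤ r) (j : Fin N) :
    |inner ℝ ((hypercubeContext e).feature j) (signVector (√d * r) s)| ≤ d * r := by
  rw [inner_hypercubeContext_feature, abs_mul, abs_of_nonneg hr, mul_comm]
  refine mul_le_mul_of_nonneg_right ((Finset.abs_sum_le_sum_abs _ _).trans ?_) hr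
  simp [abs_mul, abs_boolSign]

lemma abs_inner_hypercubeContext_feature_flip_le {r : ℝ} (hr : 0 ≤ r) (i : Fin d) (j : Fin N) :
    |inner ℝ ((hypercubeContext e).feature j) (signVector (√d * r) s) -
      inner ℝ ((hypercubeContext e).feature j)
        (signVector (√d * r) (Function.update s i (!s i)))| ≤ 2 * r := by
  rw [inner_hypercubeContext_feature, inner_hypercubeContext_feature, ← mul_sub,
    ← Finset.sum_sub_distrib, Finset.sum_eq_single i]
  · rw [Function.update_self, boolSign_not, ← mul_sub, sub_neg_eq_add, ← two_mul, abs_mul, abs_mul,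
      abs_mul, abs_boolSign, abs_boolSign, abs_of_nonneg hr, abs_two]
    linarith
  · intro k _ hk
    rw [Function.update_of_ne hk, sub_self]
  · simp

/-- The `K` copies of the vertex `s` form the benchmark assortment. -/
lemma le_optimalRevenue_hypercubeContext (r : ℝ) :
    K * Real.exp (d * r) / (1 + K * Real.exp (d * r)) ≤
      (hypercubeContext e).optimalRevenue (signVector (√d * r) s) K := by
  classical
  let S : Finset (Fin N) := Finset.univ.map
    ⟨fun k : Fin K => e.symm (k, s), fun k k' h => by simpa using h⟩
  have hS : S.card ≤ K := by simp [S]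
  have hw : ∑ j ∈ S, (hypercubeContext e).weight (signVector (√d * r) s) j =
      K * Real.exp (d * r) := by
    have hk : ∀ k : Fin K, (hypercubeContext e).weight (signVector (√d * r) s) (e.symm (k, s)) =
        Real.exp (d * r) := fun k => by
      rw [MNLContext.weight, inner_hypercubeContext_feature, Equiv.apply_symm_apply]
      simp [boolSign_mul_self, mul_comm]
    rw [Finset.sum_map]
    refine (Finset.sum_congr rfl fun k _ => hk k).trans ?_
    simp
  have hR : (hypercubeContext e).expectedRevenue (signVector (√d * r) s) S =
      K * Real.exp (d * r) / (1 + K * Real.exp (d * r)) := by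
    rw [MNLContext.expectedRevenue, ← hw]
    simp only [hypercubeContext, one_mul]
  rw [← hR]
  exact le_ciSup (f := fun S : Assortment N K =>
    (hypercubeContext e).expectedRevenue (signVector (√d * r) s) S.1)
    (Set.finite_range _).bddAbove ⟨S, hS⟩

/-- The loss of an assortment in a single coordinate of the hypercube. -/
noncomputable def coordinateLoss (S : Assortment N K) (i : Fin d) (b : Bool) : ℝ :=
  K - boolSign b * ∑ j ∈ S.1, boolSign ((e j).2 i)

lemma coordinateLoss_nonneg (S : Assortment N K) (i : Fin d) (b : Bool) :
    0 ≤ coordinateLoss e S i b := by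
  rw [coordinateLoss, sub_nonneg]
  refine (le_abs_self _).trans ?_
  rw [abs_mul, abs_boolSign, one_mul]
  refine (Finset.abs_sum_le_sum_abs _ _).trans ?_
  simp only [abs_boolSign, Finset.sum_const, nsmul_eq_mul, mul_one]
  exact_mod_cast S.2

/-- The separation used by Assouad's lemma: no assortment suits both values of a bit. -/
lemma coordinateLoss_add_not (S : Assortment N K) (i : Fin d) (b : Bool) :
    coordinateLoss e S i b + coordinateLoss e S i (!b) = 2 * K := by
  rw [coordinateLoss, coordinateLoss, boolSign_not]
  ring

/-- Utilities are linear in the bits of `s`, so the utility deficit `K * (d * r) - ∑ utilities`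
splits into `r` times the coordinate losses. -/
lemma sum_coordinateLoss_le_revenue_gap (hK : 1 ≤ K) {r : ℝ} (hr : 0 ≤ r) (hdr : d * r ≤ 1)
    (S : Assortment N K) :
    r / (48 * (K : ℝ) ^ 2) * ∑ i, coordinateLoss e S i (s i) ≤
      (hypercubeContext e).optimalRevenue (signVector (√d * r) s) K -
        (hypercubeContext e).expectedRevenue (signVector (√d * r) s) S.1 := by
  have h1 := mnl_revenue_gap S.1
    (fun j => inner ℝ ((hypercubeContext e).feature j) (signVector (√d * r) s)) hK
    (mul_nonneg d.cast_nonneg hr) hdr (abs_inner_hypercubeContext_feature_le e s hr) S.2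
  have h2 : (K : ℝ) * (d * r) -
      ∑ j ∈ S.1, inner ℝ ((hypercubeContext e).feature j) (signVector (√d * r) s) =
      r * ∑ i, coordinateLoss e S i (s i) := by
    simp only [inner_hypercubeContext_feature, coordinateLoss, Finset.sum_sub_distrib,
      ← Finset.mul_sum]
    rw [Finset.sum_comm, mul_sub]
    simp only [Finset.mul_sum, Finset.sum_const, Finset.card_univ, Fintype.card_fin, nsmul_eq_mul]
    congr 1
    · ring
    · exact Finset.sum_congr rfl fun i _ => Finset.sum_congr rfl fun j _ => by ring
  have h3 : (hypercubeContext e).expectedRevenue (signVector (√d * r) s) S.1 =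
      (∑ j ∈ S.1, Real.exp (inner ℝ ((hypercubeContext e).feature j) (signVector (√d * r) s))) /
        (1 + ∑ j ∈ S.1,
          Real.exp (inner ℝ ((hypercubeContext e).feature j) (signVector (√d * r) s))) := by
    simp only [MNLContext.expectedRevenue, MNLContext.weight, hypercubeContext, one_mul]
  rw [h2, mul_comm r, mul_div_assoc, mul_comm] at h1
  rw [h3]
  exact h1.trans (sub_le_sub_right (le_optimalRevenue_hypercubeContext e s r) _)

lemma sum_coordinateLoss_le_regret (hK : 1 ≤ K) {r : ℝ} (hr : 0 ≤ r) (hdr : d * r ≤ 1)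
    (π : AssortmentPolicy d N K T) :
    r / (48 * (K : ℝ) ^ 2) * ∑ i, ∑ h,
        π.trajectoryProb ⟨fun _ => hypercubeContext e, signVector (√d * r) s⟩ h *
          ∑ t, coordinateLoss e (h t).1 i (s i) ≤
      π.regret ⟨fun _ => hypercubeContext e, signVector (√d * r) s⟩ := by
  rw [AssortmentPolicy.regret, Finset.sum_comm, Finset.mul_sum]
  refine Finset.sum_le_sum fun h _ => ?_
  rw [← Finset.mul_sum, mul_left_comm, Finset.sum_comm, Finset.mul_sum (a := r / _)]
  exact mul_le_mul_of_nonneg_left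
    (Finset.sum_le_sum fun t _ => sum_coordinateLoss_le_revenue_gap e s hK hr hdr (h t).1)
    (π.trajectoryProb_nonneg _ h)

/-- On some vertex of the hypercube the regret is at least of order `d √T / K`. -/
lemma exists_hypercube_regret_ge (hK : 1 ≤ K) (hT : 0 < T) (hdT : d ^ 2 ≤ T)
    (π : AssortmentPolicy d N K T) :
    ∃ s : Fin d → Bool, 1 / 288 * (d * √T / K) ≤
      π.regret ⟨fun _ => hypercubeContext e, signVector (√d * (√T)⁻¹) s⟩ := by
  have hT' : (0 : ℝ) < T := by exact_mod_cast hT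
  have hsT : 0 < √(T : ℝ) := Real.sqrt_pos.2 hT'
  have hr : 0 ≤ (√(T : ℝ))⁻¹ := (inv_pos.2 hsT).le
  have hdr : d * (√(T : ℝ))⁻¹ ≤ 1 := by
    rw [← div_eq_mul_inv, div_le_one hsT]
    exact Real.le_sqrt_of_sq_le (by exact_mod_cast hdT)
  obtain ⟨s, hs⟩ := assouad_hypercube
    (fun s h => π.trajectoryProb ⟨fun _ => hypercubeContext e, signVector (√d * (√T)⁻¹) s⟩ h)
    (fun s h => π.trajectoryProb_nonneg _ h) (fun s => π.sum_trajectoryProb _)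
    (ρ := Real.exp (-(((√(T : ℝ))⁻¹) ^ 2 / 2)) ^ T) (pow_nonneg (Real.exp_pos _).le _)
    (fun s i => π.exp_le_sum_sqrt_trajectoryProb _ _ _ hr
      fun _ j => abs_inner_hypercubeContext_feature_flip_le e s hr i j)
    (fun i h b => ∑ t, coordinateLoss e (h t).1 i b)
    (fun i h b => Finset.sum_nonneg fun t _ => coordinateLoss_nonneg e _ i b) (L := T * (2 * K))
    (fun i h b => by
      rw [← Finset.sum_add_distrib]
      simp [coordinateLoss_add_not])
  refine ⟨s, le_trans ?_ (sum_coordinateLoss_le_regret e s hK hr hdr π)⟩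
  have hK' : (0 : ℝ) < K := by exact_mod_cast hK
  refine le_trans ?_ (mul_le_mul_of_nonneg_left hs (by positivity))
  have hρ : (Real.exp (-(((√(T : ℝ))⁻¹) ^ 2 / 2)) ^ T) ^ 2 = Real.exp (-1) := by
    rw [← pow_mul, ← Real.exp_nat_mul, inv_pow, Real.sq_sqrt hT'.le]
    congr 1
    push_cast
    field_simp
  have hexp : 1 / 3 ≤ Real.exp (-1) := by
    rw [Real.exp_neg, one_div]
    exact inv_anti₀ (Real.exp_pos _) (Real.exp_one_lt_d9.le.trans (by norm_num))
  rw [hρ]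
  -- With `exp(-1) ≥ 1/3`, the factor `exp(-1)/96` gives `1/288`.
  have hfac : (√(T : ℝ))⁻¹ / (48 * (K : ℝ) ^ 2) * (d * (T * (2 * K) * Real.exp (-1) / 4)) =
      Real.exp (-1) / 96 * (d * √T / K) := by
    nth_rewrite 2 [← Real.mul_self_sqrt hT'.le]
    field_simp
    ring
  rw [hfac]
  exact mul_le_mul_of_nonneg_right (by linarith) (by positivity)

end Hypercube

/-! ### The lower bound -/

theorem theorem2 :
    ∃ C₀ c₁ c₂ : ℝ, 0 < C₀ ∧ 0 < c₁ ∧ 0 < c₂ ∧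
      ∀ d : ℕ, 4 ∣ d → ∃ T₀ : ℕ, ∀ K : ℕ, 1 ≤ K →
        ∃ N : ℕ, c₁ * ((K : ℝ) * 2 ^ d) ≤ (N : ℝ) ∧ (N : ℝ) ≤ c₂ * ((K : ℝ) * 2 ^ d) ∧
          ∀ T : ℕ, T₀ ≤ T → ∀ π : AssortmentPolicy d N K T,
            ∃ I : MNLInstance d N T,
              (∀ (t : Fin T) (i : Fin N), ‖(I.context t).feature i‖ ≤ 1) ∧
              ‖I.coeff‖ ≤ 1 ∧
              C₀ * ((d : ℝ) * Real.sqrt (T : ℝ) / (K : ℝ)) ≤ π.regret I := by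
  -- `d² ≤ T` keeps the coefficient norm `d/√T` at most one; the extra `1` makes `T` positive when
  -- `d = 0`.
  refine ⟨1 / 288, 1, 1, by norm_num, one_pos, one_pos, fun d _ => ⟨d ^ 2 + 1, fun K hK => ?_⟩⟩
  obtain ⟨N, hN⟩ : ∃ N, N = K * 2 ^ d := ⟨_, rfl⟩
  have hN' : (N : ℝ) = K * 2 ^ d := by rw [hN]; push_cast; rfl
  refine ⟨N, by rw [hN', one_mul], by rw [hN', one_mul], fun T hT π => ?_⟩
  have hdT : d ^ 2 ≤ T := (Nat.le_succ _).trans hT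
  let e : Fin N ≃ Fin K × (Fin d → Bool) := Fintype.equivOfCardEq (by simp [hN])
  obtain ⟨s, hs⟩ := exists_hypercube_regret_ge e hK ((Nat.succ_pos _).trans_le hT) hdT π
  refine ⟨⟨fun _ => hypercubeContext e, signVector (√d * (√T)⁻¹) s⟩,
    fun t j => norm_hypercubeContext_feature_le e j, ?_, hs⟩
  rw [norm_signVector (by positivity), mul_right_comm, Real.mul_self_sqrt d.cast_nonneg,
    ← div_eq_mul_inv]
  refine div_le_one_of_le₀ (Real.le_sqrt_of_sq_le ?_) (Real.sqrt_nonneg _)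
  exact_mod_cast hdT
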